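/- Let $\alpha\in(0,\tfrac12)$ and let $\log$ be the natural logarithm. For $n\ge 1$ let the maximum shaping gain $\overline{\mathtt{SG}}(n;\alpha)$ be the maximum of $\sqrt[n]{\operatorname{vol}(\mathscr R)}/(2\alpha)$ over all closed sets $\mathscr R\subseteq[0,1]^n$ of positive volume with $$\frac{1}{\operatorname{vol}(\mathscr R)}\int_{\mathscr R}\|\mathbf x\|_1\,\mathrm d\mathbf x\le n\alpha .$$ This maximum exists, and it is attained by the optimal truncated cube $\mathscr T_n(t_n^\star)$, where $\mathscr T_n(t)=\{\mathbf x\in[0,1]^n:\sum_{i=1}^n x_i\le t\}$ and $t_n^\star$ is the unique $t\in(0,n]$ with $$\frac{1}{n\operatorname{vol}(\mathscr T_n(t))}\int_{\mathscr T_n(t)}\|\mathbf x\|_1\,\mathrm d\mathbf x=\alpha .$$ The equation $\alpha=\frac1\mu-\frac1{e^\mu-1}$ has a unique positive solution $\mu^*$, and, as $n\to\infty$, $$\log\overline{\mathtt{SG}}(n;\alpha)=h_{\max}(\alpha)-\log(2\alpha)-\frac{\log n}{2n}+\frac{\omega_\alpha}{n}+o\!\left(\frac1n\right),$$ where $h_{\max}(\alpha)=-\int_0^1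 p^*(x)\log p^*(x)\,\mathrm dx$ is the differential entropy of the density $$p^*(x)=\frac{\mu^*}{1-e^{-\mu^*}}\,e^{-\mu^*x},\qquad 0\le x\le 1,$$ and $$\omega_\alpha=1-\tfrac12\log\!\Big(2\pi\big(-\mu^*+2\alpha\mu^*+(\mu^*)^2\alpha(1-\alpha)\big)\Big).$$ -/

import Mathlib

open MeasureTheory Filter Asymptotics

namespace Shaping

noncomputable section

/-- The truncated cube: the points of the unit cube `[0,1]^n` with coordinate sum at most `t`. -/
def truncatedCube (n : ℕ) (t : ℝ) : Set (Fin n → ℝ) :=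
  {x | (∀ i, 0 ≤ x i ∧ x i ≤ 1) ∧ ∑ i, x i ≤ t}

/-- The average first moment of a region `R`, normalised by the dimension:
`(1 / (n vol R)) ∫_R ‖x‖₁ dx`. -/
def averageFirstMoment {n : ℕ} (R : Set (Fin n → ℝ)) : ℝ :=
  (1 / (n * volume.real R)) * ∫ x in R, ∑ i, |x i|

/-- The shaping gain of a region in `n`-space with respect to the baseline `[0, 2α]`:
`vol(R)^(1/n) / (2α)`. -/
def shapingGain {n : ℕ} (α : ℝ) (R : Set (Fin n → ℝ)) : ℝ :=
  volume.real R ^ (1 / (n : ℝ)) / (2 * α)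

/-- The shaping regions that obey the peak- and the average-intensity constraint: closed subsets
of the unit cube, of positive volume, with `(1 / vol R) ∫_R ‖x‖₁ dx ≤ n α`. -/
structure IsAdmissible {n : ℕ} (α : ℝ) (R : Set (Fin n → ℝ)) : Prop where
  isClosed : IsClosed R
  subset_cube : ∀ x ∈ R, ∀ i, 0 ≤ x i ∧ x i ≤ 1
  volume_pos : 0 < volume.real R
  average_le : (1 / volume.real R) * ∫ x in R, ∑ i, |x i| ≤ n * α

/-- The set of the shaping gains of all admissible regions in `n`-space. -/
def admissibleGains (n : ℕ) (α : ℝ) : Set ℝ :=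
  {g | ∃ R : Set (Fin n → ℝ), IsAdmissible α R ∧ g = shapingGain α R}

/-- The maximum shaping gain in `n`-space. -/
def maxShapingGain (n : ℕ) (α : ℝ) : ℝ :=
  sSup (admissibleGains n α)

/-- The differential entropy `-∫ p log p` (in nats) of a probability density on the line. -/
def differentialEntropy (p : ℝ → ℝ) : ℝ :=
  -∫ x, p x * Real.log (p x)

/-- The truncated exponential density on `[0,1]` with decay rate `μ`. -/
def truncatedExpDensity (μ : ℝ) : ℝ → ℝ :=
  Set.indicator (Set.Icc 0 1) fun x => μ / (1 - Real.exp (-μ)) * Real.exp (-μ * x)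

/-- `μ` is a positive solution of `α = 1/μ - 1/(exp μ - 1)`. -/
def IsDecayRate (α μ : ℝ) : Prop :=
  0 < μ ∧ α = 1 / μ - 1 / (Real.exp μ - 1)

/-- The constant of the term of order `1/n`. -/
def omegaConst (α μ : ℝ) : ℝ :=
  1 - 1 / 2 * Real.log (2 * Real.pi * (-μ + 2 * α * μ + μ ^ 2 * α * (1 - α)))

end

end Shaping

open scoped FourierTransform

/-! ### Truncated cubes: moments, optimal level, optimality -/

namespace Shaping

/-! Optimality is a Lagrangian argument. The slack `t - ∑ xᵢ` is nonnegative in the cube exactly on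
`truncatedCube n t`, so no region in the cube has a larger slack integral (`integral_sub_sum_le`).
If the truncated cube has mean sum `nα`, then `nα < t`, and the moment constraint turns this into a
comparison of volumes. The level exists and is unique because the mean sum is continuous and
strictly increasing in `t`.

It remains to find the volume up to a factor `1 + o(1)`. Tilt each coordinate by `e^{-μx}`: with `Z
= expMass μ`, the tilted law has mean `α` and variance `D / μ²`, where `D = scaledVariance α μ`. If
`S` is the sum of `n` independent tilted coordinates, then `vol = Z^n e^{μt} E[e^{-μ(t-S)}; S ≤ t]`.
For `t = nα + O(1)` the density of `S` near `t` is about `μ / √(2πnD)`, and `∫₀^∞ e^{-μy} dy = 1/μ`,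
so the expectation is about `1 / √(2πnD)`. The local limit theorem `tendsto_slackMoment` makes this
precise by Fourier inversion and dominated convergence.

The same theorem with one extra power of the slack shows that the mean slack tends to `1/μ`, hence
`t = nα + 1/μ + o(1)` (`tendsto_truncation_level`). So `e^{μt}` contributes `e^{nμα + 1}`: the `1`
in `omegaConst`, while `log Z + μα` is the entropy. -/

theorem truncatedCube_eq (n : ℕ) (t : ℝ) :
    truncatedCube n t = Set.Icc 0 1 ∩ {x : Fin n → ℝ | ∑ i, x i ≤ t} := by
  ext x
  simp only [truncatedCube, Set.mem_ofPred_eq, Set.mem_inter_iff, Set.mem_Icc, Pi.le_def,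
    Pi.zero_apply, Pi.one_apply, forall_and]

theorem isClosed_truncatedCube (n : ℕ) (t : ℝ) : IsClosed (truncatedCube n t) := by
  rw [truncatedCube_eq]
  exact isClosed_Icc.inter (isClosed_le (by fun_prop) continuous_const)

theorem truncatedCube_subset (n : ℕ) (t : ℝ) :
    truncatedCube n t ⊆ Set.Icc (0 : Fin n → ℝ) 1 := by
  rw [truncatedCube_eq]; exact Set.inter_subset_left

theorem truncatedCube_mono (n : ℕ) {s t : ℝ} (h : s ≤ t) :
    truncatedCube n s ⊆ truncatedCube n t := fun _ hx => ⟨hx.1, hx.2.trans h⟩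

theorem integrableOn_of_subset_cube {n : ℕ} {R : Set (Fin n → ℝ)} (hR : R ⊆ Set.Icc 0 1)
    {f : (Fin n → ℝ) → ℝ} (hf : Continuous f) : IntegrableOn f R :=
  (hf.continuousOn.integrableOn_compact isCompact_Icc).mono_set hR

theorem volume_cube (n : ℕ) : volume (Set.Icc (0 : Fin n → ℝ) 1) = 1 := by
  simp [Real.volume_Icc_pi]

theorem volume_ne_top_of_subset_cube {n : ℕ} {R : Set (Fin n → ℝ)} (hR : R ⊆ Set.Icc 0 1) :
    volume R ≠ ⊤ :=
  ne_top_of_le_ne_top (by rw [volume_cube]; simp) (measure_mono hR)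

/-- The hyperplanes of constant coordinate sum are null sets. -/
theorem volume_sum_eq (n : ℕ) (hn : 1 ≤ n) (t : ℝ) :
    volume {x : Fin n → ℝ | ∑ i, x i = t} = 0 := by
  have h0 : (n : ℝ) ≠ 0 := by positivity
  let l : (Fin n → ℝ) →ₗ[ℝ] ℝ := ∑ i, LinearMap.proj i
  have hl : ∀ x, l x = ∑ i, x i := fun x => by simp [l]
  have hker : volume ((LinearMap.ker l : Submodule ℝ (Fin n → ℝ)) : Set (Fin n → ℝ)) = 0 := by
    apply Measure.addHaar_submodule
    intro h
    have h1 : (fun _ => 1 : Fin n → ℝ) ∈ LinearMap.ker l := by rw [h]; trivial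
    rw [LinearMap.mem_ker, hl] at h1
    simp at h1
    omega
  -- Translation by the constant vector `-t/n` carries the hyperplane onto a proper subspace.
  have heq : {x : Fin n → ℝ | ∑ i, x i = t} =
      (fun x => x + fun _ => (-t / n)) ⁻¹' ((LinearMap.ker l : Submodule ℝ (Fin n → ℝ)) : Set _) := by
    ext x
    simp only [Set.mem_ofPred_eq, Set.mem_preimage, SetLike.mem_coe, LinearMap.mem_ker, hl,
      Pi.add_apply, Finset.sum_add_distrib, Finset.sum_const, Finset.card_univ, Fintype.card_fin,
      nsmul_eq_mul]
    rw [mul_div_cancel₀ _ h0]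
    constructor <;> intro h <;> linarith
  rw [heq, measure_preimage_add_right, hker]

/-- Integrals over the truncated cube depend continuously on the truncation level. -/
theorem continuous_setIntegral_truncatedCube (n : ℕ) (hn : 1 ≤ n) {f : (Fin n → ℝ) → ℝ}
    (hf : Continuous f) : Continuous fun t => ∫ x in truncatedCube n t, f x := by
  have h : ∀ t, ∫ x in truncatedCube n t, f x =
      ∫ x in Set.Icc 0 1, Set.indicator {x : Fin n → ℝ | ∑ i, x i ≤ t} f x := by
    intro t
    rw [setIntegral_indicator (measurableSet_le (by fun_prop) measurable_const),
      ← truncatedCube_eq]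
  simp_rw [h]
  rw [continuous_iff_continuousAt]
  intro t
  apply continuousAt_of_dominated (bound := fun x => ‖f x‖)
  · exact Eventually.of_forall fun s => (hf.aestronglyMeasurable).indicator
      (measurableSet_le (by fun_prop) measurable_const)
  · exact Eventually.of_forall fun s => Eventually.of_forall fun x => norm_indicator_le_norm_self _ _
  · exact integrableOn_of_subset_cube subset_rfl hf.norm
  -- Off the null hyperplane `∑ xᵢ = t` the indicator is locally constant in the level.
  · refine ae_restrict_of_ae ?_
    have h0 : ∀ᵐ x : Fin n → ℝ, ∑ i, x i ≠ t := by
      rw [ae_iff]; simpa using volume_sum_eq n hn t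
    filter_upwards [h0] with x hx
    rcases lt_or_gt_of_ne hx with h | h
    · apply (continuousAt_const (y := f x)).congr
      filter_upwards [lt_mem_nhds h] with s hs
      exact (Set.indicator_of_mem (s := {x : Fin n → ℝ | ∑ i, x i ≤ s}) (le_of_lt hs) f).symm
    · apply (continuousAt_const (y := 0)).congr
      filter_upwards [gt_mem_nhds h] with s hs
      exact (Set.indicator_of_notMem (s := {x : Fin n → ℝ | ∑ i, x i ≤ s}) (not_le.2 hs) f).symm

/-- The slices between two truncation levels have positive volume. -/
theorem volume_truncatedCube_diff_pos (n : ℕ) (hn : 1 ≤ n) {s t : ℝ} (hs : 0 ≤ s) (hst : s < t)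
    (ht : t ≤ n) : 0 < volume (truncatedCube n t \ truncatedCube n s) := by
  have hn0 : (0 : ℝ) < n := by positivity
  have hU : IsOpen (Set.pi Set.univ (fun _ : Fin n => Set.Ioo (0 : ℝ) 1) ∩
      {x | s < ∑ i, x i} ∩ {x | ∑ i, x i < t}) :=
    ((isOpen_set_pi Set.finite_univ fun _ _ => isOpen_Ioo).inter
      (isOpen_lt continuous_const (by fun_prop))).inter (isOpen_lt (by fun_prop) continuous_const)
  refine (hU.measure_pos volume ⟨fun _ => (s + t) / 2 / n, ?_⟩).trans_le (measure_mono ?_)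
  · have hsum : ∑ _i : Fin n, (s + t) / 2 / n = (s + t) / 2 := by
      simp [mul_div_cancel₀ _ hn0.ne']
    refine ⟨⟨fun i _ => ⟨div_pos (by linarith) hn0, ?_⟩, ?_⟩, ?_⟩
    · rw [div_lt_one hn0]; linarith
    · simp only [Set.mem_ofPred_eq, hsum]; linarith
    · simp only [Set.mem_ofPred_eq, hsum]; linarith
  · rintro x ⟨⟨h1, h2⟩, h3⟩
    exact ⟨⟨fun i => ⟨(h1 i trivial).1.le, (h1 i trivial).2.le⟩, le_of_lt h3⟩,
      fun h => absurd h.2 (not_le.2 h2)⟩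

/-- The integral of the coordinate sum over the truncated cube. -/
noncomputable def sumMoment (n : ℕ) (t : ℝ) : ℝ := ∫ x in truncatedCube n t, ∑ i, x i

theorem measurableSet_truncatedCube (n : ℕ) (t : ℝ) : MeasurableSet (truncatedCube n t) :=
  (isClosed_truncatedCube n t).measurableSet

theorem integrableOn_sum_of_subset_cube {n : ℕ} {R : Set (Fin n → ℝ)} (hR : R ⊆ Set.Icc 0 1) :
    IntegrableOn (fun x => ∑ i, x i) R :=
  integrableOn_of_subset_cube hR (by fun_prop)

theorem integral_sub_sum_of_subset_cube {n : ℕ} {R : Set (Fin n → ℝ)} (hR : R ⊆ Set.Icc 0 1)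
    (t : ℝ) : ∫ x in R, (t - ∑ i, x i) = t * volume.real R - ∫ x in R, ∑ i, x i := by
  rw [integral_sub (integrableOn_of_subset_cube hR continuous_const)
    (integrableOn_sum_of_subset_cube hR)]
  simp [mul_comm]

theorem volume_truncatedCube_strictMono (n : ℕ) (hn : 1 ≤ n) {s t : ℝ} (hs : 0 ≤ s) (hst : s < t)
    (ht : t ≤ n) : volume.real (truncatedCube n s) < volume.real (truncatedCube n t) := by
  have h := volume_truncatedCube_diff_pos n hn hs hst ht
  have h1 : 0 < volume.real (truncatedCube n t \ truncatedCube n s) :=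
    ENNReal.toReal_pos h.ne' (volume_ne_top_of_subset_cube
      (Set.sdiff_subset.trans (truncatedCube_subset n t)))
  rw [measureReal_sdiff (truncatedCube_mono n hst.le) (measurableSet_truncatedCube n s)
    (volume_ne_top_of_subset_cube (truncatedCube_subset n t))] at h1
  linarith

theorem volume_truncatedCube_pos (n : ℕ) (hn : 1 ≤ n) {t : ℝ} (h0 : 0 < t) (ht : t ≤ n) :
    0 < volume.real (truncatedCube n t) :=
  measureReal_nonneg.trans_lt (volume_truncatedCube_strictMono n hn le_rfl h0 ht)

theorem continuous_volume_truncatedCube (n : ℕ) (hn : 1 ≤ n) :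
    Continuous fun t => volume.real (truncatedCube n t) := by
  simpa using continuous_setIntegral_truncatedCube n hn (f := fun _ => 1) continuous_const

theorem continuous_sumMoment (n : ℕ) (hn : 1 ≤ n) : Continuous (sumMoment n) :=
  continuous_setIntegral_truncatedCube n hn (by fun_prop)

/-- On the truncated cube of level `t / 2`, which has positive volume, the slack is at least `t /
2`. -/
theorem sumMoment_lt (n : ℕ) (hn : 1 ≤ n) {t : ℝ} (h0 : 0 < t) (ht : t ≤ n) :
    sumMoment n t < t * volume.real (truncatedCube n t) := by
  have h1 := integral_sub_sum_of_subset_cube (truncatedCube_subset n t) t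
  have h2 : (t / 2) * volume.real (truncatedCube n (t / 2)) ≤
      ∫ x in truncatedCube n t, (t - ∑ i, x i) := by
    calc (t / 2) * volume.real (truncatedCube n (t / 2))
        = ∫ _x in truncatedCube n (t / 2), t / 2 := by simp [mul_comm]
      _ ≤ ∫ x in truncatedCube n (t / 2), (t - ∑ i, x i) := by
        refine setIntegral_mono_on (integrableOn_of_subset_cube (truncatedCube_subset n _)
          continuous_const) (integrableOn_of_subset_cube (truncatedCube_subset n _) (by fun_prop))
          (measurableSet_truncatedCube _ _) fun x hx => ?_
        linarith [hx.2]
      _ ≤ _ := by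
        refine setIntegral_mono_set (integrableOn_of_subset_cube (truncatedCube_subset n _)
          (by fun_prop)) ?_ (truncatedCube_mono n (by linarith)).eventuallyLE
        refine (ae_restrict_iff' (measurableSet_truncatedCube n t)).2 (Eventually.of_forall ?_)
        intro x hx
        exact sub_nonneg.2 hx.2
  have h3 := volume_truncatedCube_pos n hn (half_pos h0) (by linarith)
  have : 0 < (t / 2) * volume.real (truncatedCube n (t / 2)) := by positivity
  unfold sumMoment
  linarith

/-- The mean coordinate sum of the truncated cube strictly increases with the truncation level. -/
theorem sumMoment_div_strictMono (n : ℕ) (hn : 1 ≤ n) {s t : ℝ} (hs : 0 < s) (hst : s < t)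
    (ht : t ≤ n) : sumMoment n s / volume.real (truncatedCube n s) <
      sumMoment n t / volume.real (truncatedCube n t) := by
  have hVs := volume_truncatedCube_pos n hn hs (by linarith)
  have hVt := volume_truncatedCube_pos n hn (hs.trans hst) ht
  have hlt := volume_truncatedCube_strictMono n hn hs.le hst ht
  have hM := sumMoment_lt n hn hs (by linarith)
  have hsub : truncatedCube n t \ truncatedCube n s ⊆ Set.Icc 0 1 :=
    Set.sdiff_subset.trans (truncatedCube_subset n t)
  have hd : ∫ x in truncatedCube n t \ truncatedCube n s, ∑ i, x i =
      sumMoment n t - sumMoment n s :=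
    setIntegral_sdiff (measurableSet_truncatedCube n s)
      (integrableOn_sum_of_subset_cube (truncatedCube_subset n t)) (truncatedCube_mono n hst.le)
  -- Points gained in passing from `s` to `t` have coordinate sum at least `s`, whereas the mean at
  -- level `s` is below `s`.
  have hd2 : s * (volume.real (truncatedCube n t) - volume.real (truncatedCube n s)) ≤
      sumMoment n t - sumMoment n s := by
    rw [← hd, ← measureReal_sdiff (truncatedCube_mono n hst.le) (measurableSet_truncatedCube n s)
      (volume_ne_top_of_subset_cube (truncatedCube_subset n t))]
    calc s * volume.real (truncatedCube n t \ truncatedCube n s)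
        = ∫ _x in truncatedCube n t \ truncatedCube n s, s := by simp [mul_comm]
      _ ≤ _ := by
        refine setIntegral_mono_on (integrableOn_of_subset_cube hsub continuous_const)
          (integrableOn_sum_of_subset_cube hsub)
          ((measurableSet_truncatedCube _ _).diff (measurableSet_truncatedCube _ _)) fun x hx => ?_
        by_contra h
        exact hx.2 ⟨hx.1.1, (not_le.1 h).le⟩
  rw [div_lt_div_iff₀ hVs hVt]
  nlinarith [mul_pos (sub_pos.2 hlt) (sub_pos.2 hM)]

theorem truncatedCube_self (n : ℕ) : truncatedCube n n = Set.Icc 0 1 := by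
  rw [truncatedCube_eq, Set.inter_eq_left]
  intro x hx
  calc ∑ i, x i ≤ ∑ _i : Fin n, (1 : ℝ) := Finset.sum_le_sum fun i _ => hx.2 i
    _ = n := by simp

theorem volume_restrict_cube (n : ℕ) : (volume : Measure (Fin n → ℝ)).restrict (Set.Icc 0 1) =
    Measure.pi fun _ => (volume : Measure ℝ).restrict (Set.Icc 0 1) := by
  rw [← Measure.restrict_pi_pi, volume_pi]
  congr 1
  exact (Set.pi_univ_Icc (0 : Fin n → ℝ) 1).symm

/-- The upper end of the intermediate value argument for the level: `n / 2` exceeds `nα`. -/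
theorem sumMoment_self (n : ℕ) : sumMoment n n = n / 2 := by
  have : IsProbabilityMeasure ((volume : Measure ℝ).restrict (Set.Icc 0 1)) := ⟨by simp⟩
  rw [sumMoment, truncatedCube_self, volume_restrict_cube, integral_finsetSum]
  · have h : ∀ i : Fin n, ∫ x : Fin n → ℝ, x i
        ∂(Measure.pi fun _ => (volume : Measure ℝ).restrict (Set.Icc 0 1)) = 1 / 2 := by
      intro i
      rw [integral_comp_eval (X := fun _ : Fin n => ℝ) (f := fun y : ℝ => y)
        (μ := fun _ => volume.restrict (Set.Icc 0 1)) (by fun_prop),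
        integral_Icc_eq_integral_Ioc, ← intervalIntegral.integral_of_le zero_le_one]
      simp
    simp [h, div_eq_mul_inv]
  · intro i _
    rw [← volume_restrict_cube]
    exact integrableOn_of_subset_cube subset_rfl (by fun_prop)

theorem setIntegral_abs_eq {n : ℕ} {R : Set (Fin n → ℝ)} (hm : MeasurableSet R)
    (hR : R ⊆ Set.Icc 0 1) : ∫ x in R, ∑ i, |x i| = ∫ x in R, ∑ i, x i :=
  setIntegral_congr_fun hm fun _ hx => Finset.sum_congr rfl fun i _ => abs_of_nonneg ((hR hx).1 i)

theorem averageFirstMoment_truncatedCube (n : ℕ) (t : ℝ) :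
    averageFirstMoment (truncatedCube n t) =
      sumMoment n t / volume.real (truncatedCube n t) / n := by
  rw [averageFirstMoment, setIntegral_abs_eq (measurableSet_truncatedCube n t)
    (truncatedCube_subset n t), ← sumMoment, div_div, mul_comm (n : ℝ), one_div_mul_eq_div]

theorem averageFirstMoment_truncatedCube_eq_iff (n : ℕ) (hn : 1 ≤ n) (t α : ℝ) :
    averageFirstMoment (truncatedCube n t) = α ↔
      sumMoment n t / volume.real (truncatedCube n t) = n * α := by
  have hn0 : (0 : ℝ) < n := by positivity
  rw [averageFirstMoment_truncatedCube, div_eq_iff hn0.ne', mul_comm α]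

/-- Exactly one truncation level meets the average-intensity constraint with equality. -/
theorem existsUnique_truncation_level {α : ℝ} (hα₀ : 0 < α) (hα₁ : α < 1 / 2) (n : ℕ)
    (hn : 1 ≤ n) : ∃! t : ℝ, t ∈ Set.Ioc (0 : ℝ) n ∧
      averageFirstMoment (truncatedCube n t) = α := by
  have hn0 : (0 : ℝ) < n := by positivity
  have hle : n * α ≤ (n : ℝ) := by nlinarith
  have hpos : 0 < n * α := by positivity
  have hV : ∀ t ∈ Set.Icc (n * α) (n : ℝ), volume.real (truncatedCube n t) ≠ 0 := fun t ht =>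
    (volume_truncatedCube_pos n hn (hpos.trans_le ht.1) ht.2).ne'
  have hc : ContinuousOn (fun t => sumMoment n t / volume.real (truncatedCube n t))
      (Set.Icc (n * α) n) :=
    (continuous_sumMoment n hn).continuousOn.div
      (continuous_volume_truncatedCube n hn).continuousOn hV
  have h1 : sumMoment n (n * α) / volume.real (truncatedCube n (n * α)) ≤ n * α := by
    rw [div_le_iff₀ (volume_truncatedCube_pos n hn hpos hle)]
    exact (sumMoment_lt n hn hpos hle).le
  have h2 : n * α ≤ sumMoment n n / volume.real (truncatedCube n n) := by
    rw [sumMoment_self, truncatedCube_self, Measure.real, volume_cube]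
    simp only [ENNReal.toReal_one, div_one]
    nlinarith
  obtain ⟨t, ht, hft⟩ := intermediate_value_Icc hle hc ⟨h1, h2⟩
  simp only at hft
  refine ⟨t, ⟨⟨hpos.trans_le ht.1, ht.2⟩, ?_⟩, ?_⟩
  · exact (averageFirstMoment_truncatedCube_eq_iff n hn t α).2 hft
  · rintro s ⟨hs, hfs⟩
    rw [averageFirstMoment_truncatedCube_eq_iff n hn] at hfs
    rcases lt_trichotomy s t with h | h | h
    · exact absurd (sumMoment_div_strictMono n hn hs.1 h ht.2) (by rw [hfs, hft]; exact lt_irrefl _)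
    · exact h
    · exact absurd (sumMoment_div_strictMono n hn (hpos.trans_le ht.1) h hs.2)
        (by rw [hfs, hft]; exact lt_irrefl _)

/-- Among the regions in the cube, the truncated cube maximises the integral of the slack. -/
theorem integral_sub_sum_le {n : ℕ} {R : Set (Fin n → ℝ)} (hm : MeasurableSet R)
    (hR : R ⊆ Set.Icc 0 1) (t : ℝ) :
    ∫ x in R, (t - ∑ i, x i) ≤ ∫ x in truncatedCube n t, (t - ∑ i, x i) := by
  have hc : Continuous fun x : Fin n → ℝ => t - ∑ i, x i := by fun_prop
  calc ∫ x in R, (t - ∑ i, x i)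
      = (∫ x in R ∩ truncatedCube n t, (t - ∑ i, x i)) +
          ∫ x in R \ truncatedCube n t, (t - ∑ i, x i) :=
        (integral_inter_add_sdiff (measurableSet_truncatedCube n t)
          (integrableOn_of_subset_cube hR hc)).symm
    _ ≤ (∫ x in truncatedCube n t, (t - ∑ i, x i)) + 0 := by
        refine add_le_add ?_ ?_
        · refine setIntegral_mono_set (integrableOn_of_subset_cube (truncatedCube_subset n _) hc)
            ?_ Set.inter_subset_right.eventuallyLE
          refine (ae_restrict_iff' (measurableSet_truncatedCube n t)).2 (Eventually.of_forall ?_)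
          intro x hx
          exact sub_nonneg.2 hx.2
        · refine setIntegral_nonpos (hm.diff (measurableSet_truncatedCube n t)) fun x hx => ?_
          by_contra h
          exact hx.2 ⟨fun i => ⟨(hR hx.1).1 i, (hR hx.1).2 i⟩, by linarith⟩
    _ = _ := add_zero _

/-- The slack integral of `R` is at least `(t - nα) vol R` by the constraint, with equality for the
truncated cube; the multiplier `t - nα` is positive and cancels. -/
theorem volume_le_of_isAdmissible {α : ℝ} {n : ℕ} (hn : 1 ≤ n)
    {t : ℝ} (ht : t ∈ Set.Ioc (0 : ℝ) n) (h : averageFirstMoment (truncatedCube n t) = α)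
    {R : Set (Fin n → ℝ)} (hR : IsAdmissible α R) :
    volume.real R ≤ volume.real (truncatedCube n t) := by
  have hsub : R ⊆ Set.Icc 0 1 := fun x hx =>
    ⟨fun i => (hR.subset_cube x hx i).1, fun i => (hR.subset_cube x hx i).2⟩
  have hm := hR.isClosed.measurableSet
  have hV := volume_truncatedCube_pos n hn ht.1 ht.2
  have hlt := sumMoment_lt n hn ht.1 ht.2
  rw [averageFirstMoment_truncatedCube_eq_iff n hn, div_eq_iff hV.ne'] at h
  have h1 := integral_sub_sum_le hm hsub t
  rw [integral_sub_sum_of_subset_cube hsub, integral_sub_sum_of_subset_cube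
    (truncatedCube_subset n t), ← sumMoment, h] at h1
  have h2 := hR.average_le
  rw [setIntegral_abs_eq hm hsub, one_div_mul_eq_div, div_le_iff₀ hR.volume_pos] at h2
  rw [h] at hlt
  have h3 : n * α < t := lt_of_mul_lt_mul_right hlt hV.le
  have h4 : (t - n * α) * volume.real R ≤ (t - n * α) * volume.real (truncatedCube n t) := by
    linarith
  exact le_of_mul_le_mul_left h4 (sub_pos.2 h3)

theorem isAdmissible_truncatedCube {α : ℝ} {n : ℕ} (hn : 1 ≤ n) {t : ℝ}
    (ht : t ∈ Set.Ioc (0 : ℝ) n) (h : averageFirstMoment (truncatedCube n t) = α) :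
    IsAdmissible α (truncatedCube n t) where
  isClosed := isClosed_truncatedCube n t
  subset_cube := fun _ hx => hx.1
  volume_pos := volume_truncatedCube_pos n hn ht.1 ht.2
  average_le := by
    rw [averageFirstMoment_truncatedCube_eq_iff n hn] at h
    rw [setIntegral_abs_eq (measurableSet_truncatedCube n t) (truncatedCube_subset n t),
      one_div_mul_eq_div]
    exact h.le

theorem isGreatest_shapingGain_truncatedCube {α : ℝ} (hα₀ : 0 < α) {n : ℕ} (hn : 1 ≤ n) {t : ℝ}
    (ht : t ∈ Set.Ioc (0 : ℝ) n) (h : averageFirstMoment (truncatedCube n t) = α) :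
    IsGreatest (admissibleGains n α) (shapingGain α (truncatedCube n t)) := by
  refine ⟨⟨_, isAdmissible_truncatedCube hn ht h, rfl⟩, ?_⟩
  rintro g ⟨R, hR, rfl⟩
  unfold shapingGain
  have := volume_le_of_isAdmissible hn ht h hR
  gcongr

theorem maxShapingGain_eq {α : ℝ} (hα₀ : 0 < α) {n : ℕ} (hn : 1 ≤ n) {t : ℝ}
    (ht : t ∈ Set.Ioc (0 : ℝ) n) (h : averageFirstMoment (truncatedCube n t) = α) :
    maxShapingGain n α = shapingGain α (truncatedCube n t) :=
  (isGreatest_shapingGain_truncatedCube hα₀ hn ht h).csSup_eq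

end Shaping

/-! ### The decay rate and the entropy of the truncated exponential law -/

namespace Shaping

/-- The right-hand side of the equation for the decay rate: the mean of the truncated exponential
density. -/
noncomputable def decayMean (μ : ℝ) : ℝ := 1 / μ - 1 / (Real.exp μ - 1)

theorem exp_sub_one_pos {μ : ℝ} (hμ : 0 < μ) : 0 < Real.exp μ - 1 :=
  sub_pos.2 (Real.one_lt_exp_iff.2 hμ)

/-- This is `x < sinh x` at `x = μ / 2`, squared. It underlies the monotonicity of `decayMean`, the
positivity of the variance and the decay of the characteristic function. -/
theorem sq_mul_exp_lt {μ : ℝ} (hμ : 0 < μ) : μ ^ 2 * Real.exp μ < (Real.exp μ - 1) ^ 2 := by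
  have h := Real.self_lt_sinh_iff.2 (half_pos hμ)
  rw [Real.sinh_eq] at h
  have hp := Real.exp_pos (μ / 2)
  have h1 : Real.exp μ = Real.exp (μ / 2) ^ 2 := by rw [← Real.exp_nat_mul]; congr 1; push_cast; ring
  have h2 : Real.exp (-(μ / 2)) * Real.exp (μ / 2) = 1 := by rw [← Real.exp_add]; simp
  have h3 : μ * Real.exp (μ / 2) < Real.exp μ - 1 := by
    rw [h1]
    nlinarith [mul_lt_mul_of_pos_right h hp]
  calc μ ^ 2 * Real.exp μ = (μ * Real.exp (μ / 2)) ^ 2 := by rw [h1]; ring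
    _ < _ := by gcongr

theorem hasDerivAt_decayMean {μ : ℝ} (hμ : 0 < μ) :
    HasDerivAt decayMean (-1 / μ ^ 2 + Real.exp μ / (Real.exp μ - 1) ^ 2) μ := by
  have h1 := (hasDerivAt_id μ).inv hμ.ne'
  have h2 := ((Real.hasDerivAt_exp μ).sub_const 1).inv (exp_sub_one_pos hμ).ne'
  have h3 := h1.sub h2
  have h4 : decayMean = (id⁻¹ : ℝ → ℝ) - (fun x => Real.exp x - 1)⁻¹ := by
    ext x; simp [decayMean]
  rw [h4]
  exact h3.congr_deriv (by simp only [id]; ring)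

theorem decayMean_strictAntiOn : StrictAntiOn decayMean (Set.Ioi 0) := by
  apply strictAntiOn_of_deriv_neg (convex_Ioi 0)
  · exact fun x hx => (hasDerivAt_decayMean hx).continuousAt.continuousWithinAt
  · intro x hx
    rw [interior_Ioi] at hx
    have hx : 0 < x := hx
    rw [(hasDerivAt_decayMean hx).deriv]
    have h := exp_sub_one_pos hx
    have : Real.exp x / (Real.exp x - 1) ^ 2 < 1 / x ^ 2 := by
      rw [div_lt_div_iff₀ (by positivity) (by positivity)]
      linarith [sq_mul_exp_lt hx]
    rw [neg_div]
    linarith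

theorem existsUnique_isDecayRate {α : ℝ} (hα₀ : 0 < α) (hα₁ : α < 1 / 2) :
    ∃! μ : ℝ, IsDecayRate α μ := by
  -- The bracket is `[1/α - 2, 1/α]`. At the left end, `e^a - 1 ≥ a + a²/2` gives `decayMean a ≥
  -- 1/(a + 2) = α`; at the right end, drop the subtracted term.
  set a := 1 / α - 2 with ha
  have ha0 : 0 < a := by
    have : 2 < 1 / α := by rw [lt_div_iff₀ hα₀]; linarith
    linarith
  have hb : 1 / α = a + 2 := by linarith
  have h1 : α ≤ decayMean a := by
    have hq := Real.quadratic_le_exp_of_nonneg ha0.le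
    have h2 : 1 / (Real.exp a - 1) ≤ 1 / (a + a ^ 2 / 2) :=
      one_div_le_one_div_of_le (by positivity) (by linarith)
    have h3 : 1 / a - 1 / (a + a ^ 2 / 2) = 1 / (a + 2) := by field_simp; ring
    have h4 : α = 1 / (a + 2) := by rw [← hb]; field_simp
    unfold decayMean
    linarith
  have h2 : decayMean (1 / α) ≤ α := by
    have := exp_sub_one_pos (one_div_pos.2 hα₀)
    have h3 : 0 < 1 / (Real.exp (1 / α) - 1) := by positivity
    unfold decayMean
    rw [one_div_one_div]
    linarith
  have hc : ContinuousOn decayMean (Set.Icc a (1 / α)) := fun x hx =>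
    (hasDerivAt_decayMean (ha0.trans_le hx.1)).continuousAt.continuousWithinAt
  obtain ⟨μ, hμ, h⟩ := intermediate_value_Icc' (by linarith) hc ⟨h2, h1⟩
  refine ⟨μ, ⟨ha0.trans_le hμ.1, h.symm⟩, fun ν hν => ?_⟩
  exact decayMean_strictAntiOn.injOn hν.1 (ha0.trans_le hμ.1) (hν.2.symm.trans h.symm)

/-- The normalising constant `∫₀¹ e^{-μx} dx` of the truncated exponential density. -/
noncomputable def expMass (μ : ℝ) : ℝ := (1 - Real.exp (-μ)) / μ

theorem expMass_pos {μ : ℝ} (hμ : 0 < μ) : 0 < expMass μ :=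
  div_pos (sub_pos.2 (Real.exp_lt_one_iff.2 (by linarith))) hμ

theorem integral_exp_unit {μ : ℝ} (hμ : 0 < μ) :
    ∫ x in Set.Icc (0 : ℝ) 1, Real.exp (-μ * x) = expMass μ := by
  rw [integral_Icc_eq_integral_Ioc, ← intervalIntegral.integral_of_le zero_le_one]
  rw [intervalIntegral.integral_comp_mul_left (fun x => Real.exp x) (neg_ne_zero.2 hμ.ne')]
  simp [expMass]
  field_simp
  ring

/-- Divided by `expMass μ`, this identifies `IsDecayRate α μ` as the condition that the tilted law
has mean `α`. -/
theorem integral_mul_exp_unit {μ : ℝ} (hμ : 0 < μ) :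
    ∫ x in Set.Icc (0 : ℝ) 1, x * Real.exp (-μ * x) = decayMean μ * expMass μ := by
  rw [integral_Icc_eq_integral_Ioc, ← intervalIntegral.integral_of_le zero_le_one]
  have hd : ∀ x ∈ Set.uIcc (0 : ℝ) 1, HasDerivAt
      (fun x => -(x / μ + 1 / μ ^ 2) * Real.exp (-μ * x)) (x * Real.exp (-μ * x)) x := by
    intro x _
    have h1 : HasDerivAt (fun x => -(x / μ + 1 / μ ^ 2)) (-(1 / μ)) x :=
      (((hasDerivAt_id x).div_const μ).add_const _).neg
    have h2 : HasDerivAt (fun x => Real.exp (-μ * x)) (Real.exp (-μ * x) * (-μ * 1)) x :=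
      ((hasDerivAt_id x).const_mul (-μ)).exp
    refine (h1.mul h2).congr_deriv ?_
    field_simp
    ring
  rw [intervalIntegral.integral_eq_sub_of_hasDerivAt hd
    (Continuous.intervalIntegrable (by fun_prop) _ _)]
  have h := exp_sub_one_pos hμ
  simp only [decayMean, expMass, mul_one, mul_zero, Real.exp_zero, Real.exp_neg]
  field_simp
  ring

/-- The entropy of the truncated exponential density. -/
theorem differentialEntropy_truncatedExpDensity {α μ : ℝ} (h : IsDecayRate α μ) :
    differentialEntropy (truncatedExpDensity μ) = Real.log (expMass μ) + μ * α := by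
  have hμ := h.1
  have hZ := expMass_pos hμ
  have hα : α = decayMean μ := h.2
  have hc : μ / (1 - Real.exp (-μ)) = (expMass μ)⁻¹ := by rw [expMass, inv_div]
  have h1 : (fun x => truncatedExpDensity μ x * Real.log (truncatedExpDensity μ x)) =
      Set.indicator (Set.Icc 0 1) fun x =>
        -(expMass μ)⁻¹ * Real.log (expMass μ) * Real.exp (-μ * x) +
          -(expMass μ)⁻¹ * μ * (x * Real.exp (-μ * x)) := by
    ext x
    by_cases hx : x ∈ Set.Icc (0 : ℝ) 1
    · simp only [truncatedExpDensity, Set.indicator_of_mem hx, hc]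
      rw [Real.log_mul (by positivity) (by positivity), Real.log_exp, Real.log_inv]
      ring
    · simp only [truncatedExpDensity, Set.indicator_of_notMem hx, zero_mul]
  rw [differentialEntropy, h1, integral_indicator measurableSet_Icc, integral_add,
    integral_const_mul, integral_const_mul, integral_exp_unit hμ, integral_mul_exp_unit hμ, ← hα]
  · field_simp
    ring
  · exact (Continuous.integrableOn_Icc (by fun_prop))
  · exact (Continuous.integrableOn_Icc (by fun_prop))

end Shaping

/-! ### Fourier inversion for tilted convolutions over the cube -/

namespace Shaping

/-- The tilted convolution of a function on the line with the uniform law of the coordinate sum on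
the unit cube. -/
noncomputable def cubeConvolution (n : ℕ) (μ : ℝ) (G : ℝ → ℂ) (t : ℝ) : ℂ :=
  ∫ x in Set.Icc (0 : Fin n → ℝ) 1, Complex.exp (-μ * ∑ i, (x i : ℂ)) * G (t - ∑ i, x i)

/-- The Laplace transform of the uniform law on `[0,1]`. -/
noncomputable def unitLaplace (s : ℂ) : ℂ := (1 - Complex.exp (-s)) / s

theorem integral_cexp_unit {s : ℂ} (hs : s ≠ 0) :
    ∫ y in Set.Icc (0 : ℝ) 1, Complex.exp (-s * y) = unitLaplace s := by
  rw [integral_Icc_eq_integral_Ioc, ← intervalIntegral.integral_of_le zero_le_one,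
    integral_exp_mul_complex (neg_ne_zero.2 hs)]
  simp only [unitLaplace, Complex.ofReal_one, mul_one, Complex.ofReal_zero, mul_zero,
    Complex.exp_zero]
  field_simp
  ring

theorem integral_cexp_sum_cube (n : ℕ) {s : ℂ} (hs : s ≠ 0) :
    ∫ x in Set.Icc (0 : Fin n → ℝ) 1, Complex.exp (-s * ∑ i, (x i : ℂ)) = unitLaplace s ^ n := by
  rw [volume_restrict_cube]
  simp_rw [Finset.mul_sum, Complex.exp_sum]
  rw [integral_fintype_prod_eq_pow (fun y : ℝ => Complex.exp (-s * y)), integral_cexp_unit hs,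
    Fintype.card_fin]

theorem integrable_cubeConvolution_integrand (n : ℕ) (μ : ℝ) {G : ℝ → ℂ} (hm : Measurable G)
    (hG : Integrable G) : Integrable
      (fun p : (Fin n → ℝ) × ℝ => Complex.exp (-μ * ∑ i, (p.1 i : ℂ)) * G (p.2 - ∑ i, p.1 i))
      ((volume.restrict (Set.Icc 0 1)).prod volume) := by
  have hc : Continuous fun x : Fin n → ℝ => Complex.exp (-μ * ∑ i, (x i : ℂ)) := by fun_prop
  rw [integrable_prod_iff]
  · constructor
    · exact Eventually.of_forall fun x => (hG.comp_sub_right (∑ i, x i)).const_mul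
        (Complex.exp (-μ * ∑ i, (x i : ℂ)))
    · have h : ∀ x : Fin n → ℝ,
          ∫ y : ℝ, ‖Complex.exp (-μ * ∑ i, (x i : ℂ)) * G (y - ∑ i, x i)‖ =
            ‖Complex.exp (-μ * ∑ i, (x i : ℂ))‖ * ∫ y, ‖G y‖ := by
        intro x
        simp_rw [norm_mul]
        rw [integral_const_mul, integral_sub_right_eq_self (fun y => ‖G y‖)]
      simp_rw [h]
      exact integrableOn_of_subset_cube subset_rfl (by fun_prop)
  · refine Measurable.aestronglyMeasurable ?_
    have h1 : Measurable fun p : (Fin n → ℝ) × ℝ => p.2 - ∑ i, p.1 i := by fun_prop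
    exact (hc.measurable.comp measurable_fst).mul (hm.comp h1)

theorem integrable_cubeConvolution (n : ℕ) (μ : ℝ) {G : ℝ → ℂ} (hm : Measurable G)
    (hG : Integrable G) : Integrable (cubeConvolution n μ G) :=
  (integrable_cubeConvolution_integrand n μ hm hG).integral_prod_right

/-- Translating `t` by the coordinate sum splits the character; its second factor shifts the tilt
from `μ` to `μ + 2πiu`, and the cube integral factors over coordinates. -/
theorem fourier_cubeConvolution (n : ℕ) {μ : ℝ} (hμ : 0 < μ) {G : ℝ → ℂ} (hm : Measurable G)
    (hG : Integrable G) (u : ℝ) :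
    𝓕 (cubeConvolution n μ G) u = 𝓕 G u * unitLaplace (μ + 2 * Real.pi * u * Complex.I) ^ n := by
  have hs : (μ + 2 * Real.pi * u * Complex.I : ℂ) ≠ 0 := by
    intro h
    have := congrArg Complex.re h
    simp at this
    exact hμ.ne' this
  have hint := integrable_cubeConvolution_integrand n μ hm hG
  have hint2 : Integrable (Function.uncurry fun (t : ℝ) (x : Fin n → ℝ) =>
      Complex.exp (↑(-2 * Real.pi * t * u) * Complex.I) •
        (Complex.exp (-μ * ∑ i, (x i : ℂ)) * G (t - ∑ i, x i)))
      (volume.prod (volume.restrict (Set.Icc 0 1))) := by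
    refine Integrable.bdd_mul (c := 1) hint.swap ?_ ?_
    · exact Continuous.aestronglyMeasurable (by fun_prop)
    · exact Eventually.of_forall fun p => (Complex.norm_exp_ofReal_mul_I _).le
  rw [Real.fourier_real_eq_integral_exp_smul]
  simp_rw [cubeConvolution, ← integral_smul]
  rw [integral_integral_swap hint2, ← integral_cexp_sum_cube n hs, ← integral_const_mul]
  congr 1
  ext x
  rw [Real.fourier_real_eq_integral_exp_smul, ← integral_mul_const]
  rw [← integral_add_right_eq_self _ (∑ i, x i)]
  congr 1
  ext t
  simp only [add_sub_cancel_right, smul_eq_mul]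
  have h : Complex.exp (↑(-2 * Real.pi * (t + ∑ i, x i) * u) * Complex.I) *
      Complex.exp (-μ * ∑ i, (x i : ℂ)) = Complex.exp (↑(-2 * Real.pi * t * u) * Complex.I) *
        Complex.exp (-(μ + 2 * Real.pi * u * Complex.I) * ∑ i, (x i : ℂ)) := by
    rw [← Complex.exp_add, ← Complex.exp_add]
    congr 1
    push_cast
    ring
  linear_combination G t * h

/-- Continuity of the convolution makes inversion valid at every `t`, not only almost everywhere. -/
theorem cubeConvolution_eq_integral (n : ℕ) {μ : ℝ} (hμ : 0 < μ) {G : ℝ → ℂ} (hm : Measurable G)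
    (hG : Integrable G) (hc : Continuous (cubeConvolution n μ G))
    (hi : Integrable fun u : ℝ =>
      𝓕 G u * unitLaplace (μ + 2 * Real.pi * u * Complex.I) ^ n) (t : ℝ) :
    cubeConvolution n μ G t = ∫ u : ℝ, Complex.exp (↑(2 * Real.pi * u * t) * Complex.I) *
      (𝓕 G u * unitLaplace (μ + 2 * Real.pi * u * Complex.I) ^ n) := by
  have h1 : 𝓕 (cubeConvolution n μ G) = fun u : ℝ =>
      𝓕 G u * unitLaplace (μ + 2 * Real.pi * u * Complex.I) ^ n :=
    funext (fourier_cubeConvolution n hμ hm hG)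
  have h2 := congrFun (hc.fourierInv_fourier_eq (integrable_cubeConvolution n μ hm hG)
    (by rw [h1]; exact hi)) t
  rw [← h2, Real.fourierInv_eq', h1]
  congr 1
  ext u
  rw [smul_eq_mul]
  congr 4
  simp
  ring

/-- The exponentially damped one-sided power function. -/
noncomputable def dampedPow (μ : ℝ) (k : ℕ) : ℝ → ℂ :=
  Set.indicator (Set.Ici 0) fun y : ℝ => (y : ℂ) ^ k * Complex.exp (-μ * y)

theorem measurable_dampedPow (μ : ℝ) (k : ℕ) : Measurable (dampedPow μ k) :=
  Measurable.indicator (by fun_prop) measurableSet_Ici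

theorem integrableOn_pow_mul_cexp {s : ℂ} (hs : 0 < s.re) (k : ℕ) :
    IntegrableOn (fun y : ℝ => (y : ℂ) ^ k * Complex.exp (-s * y)) (Set.Ioi 0) := by
  have h := integrableOn_rpow_mul_exp_neg_mul_rpow (s := k) (p := 1) (b := s.re)
    (by linarith [Nat.cast_nonneg (α := ℝ) k]) one_pos hs
  refine Integrable.mono' h (Continuous.aestronglyMeasurable (by fun_prop)) ?_
  refine (ae_restrict_iff' measurableSet_Ioi).2 (Eventually.of_forall fun y hy => ?_)
  have hy : 0 < y := hy
  simp [Complex.norm_exp, abs_of_pos hy]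

theorem integrable_dampedPow {μ : ℝ} (hμ : 0 < μ) (k : ℕ) : Integrable (dampedPow μ k) := by
  rw [dampedPow, integrable_indicator_iff measurableSet_Ici, integrableOn_Ici_iff_integrableOn_Ioi]
  exact integrableOn_pow_mul_cexp (by simpa using hμ) k

theorem fourier_dampedPow (μ : ℝ) (k : ℕ) (u : ℝ) :
    𝓕 (dampedPow μ k) u = ∫ y in Set.Ioi (0 : ℝ),
      (y : ℂ) ^ k * Complex.exp (-(μ + 2 * Real.pi * u * Complex.I) * y) := by
  rw [Real.fourier_real_eq_integral_exp_smul, ← integral_Ici_eq_integral_Ioi,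
    ← integral_indicator measurableSet_Ici]
  congr 1
  ext y
  by_cases hy : y ∈ Set.Ici (0 : ℝ)
  · simp only [dampedPow, Set.indicator_of_mem hy, smul_eq_mul]
    rw [mul_left_comm, ← Complex.exp_add]
    congr 2
    push_cast
    ring
  · simp only [dampedPow, Set.indicator_of_notMem hy, smul_zero]

theorem integral_mul_cexp_Ioi {s : ℂ} (hs : 0 < s.re) :
    ∫ y in Set.Ioi (0 : ℝ), (y : ℂ) * Complex.exp (-s * y) = 1 / s ^ 2 := by
  have hs0 : s ≠ 0 := by rintro rfl; simp at hs
  have hd : ∀ y ∈ Set.Ici (0 : ℝ), HasDerivAt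
      (fun y : ℝ => -(y / s + 1 / s ^ 2) * Complex.exp (-s * y)) (y * Complex.exp (-s * y)) y := by
    intro y _
    have h0 : HasDerivAt (fun y : ℝ => (y : ℂ)) 1 y := Complex.ofRealCLM.hasDerivAt
    have h1 : HasDerivAt (fun y : ℝ => -((y : ℂ) / s + 1 / s ^ 2)) (-(1 / s)) y :=
      ((h0.div_const s).add_const _).neg
    have h2 : HasDerivAt (fun y : ℝ => Complex.exp (-s * y)) (Complex.exp (-s * y) * (-s * 1)) y :=
      (h0.const_mul (-s)).cexp
    refine (h1.mul h2).congr_deriv ?_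
    field_simp
    ring
  have hi := integrableOn_pow_mul_cexp hs 1
  simp only [pow_one] at hi
  have hlim : ∀ k : ℕ, Tendsto (fun y : ℝ => (y : ℂ) ^ k * Complex.exp (-s * y)) atTop (nhds 0) := by
    intro k
    rw [tendsto_zero_iff_norm_tendsto_zero]
    refine (tendsto_rpow_mul_exp_neg_mul_atTop_nhds_zero k s.re hs).congr' ?_
    filter_upwards [eventually_gt_atTop 0] with y hy
    simp [Complex.norm_exp, abs_of_pos hy]
  have hl : Tendsto (fun y : ℝ => -(y / s + 1 / s ^ 2) * Complex.exp (-s * y)) atTop (nhds 0) := by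
    have h := ((hlim 1).const_mul (-(1 / s))).add ((hlim 0).const_mul (-(1 / s ^ 2)))
    rw [mul_zero, mul_zero, add_zero] at h
    refine h.congr fun y => ?_
    ring
  rw [integral_Ioi_of_hasDerivAt_of_tendsto' hd hi hl]
  simp

theorem re_add_mul_I_pos {μ : ℝ} (hμ : 0 < μ) (u : ℝ) :
    0 < (μ + 2 * Real.pi * u * Complex.I : ℂ).re := by
  simpa using hμ

theorem fourier_dampedPow_zero {μ : ℝ} (hμ : 0 < μ) (u : ℝ) :
    𝓕 (dampedPow μ 0) u = 1 / (μ + 2 * Real.pi * u * Complex.I) := by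
  rw [fourier_dampedPow]
  simp only [pow_zero, one_mul]
  rw [integral_exp_mul_complex_Ioi (by simpa using hμ), Complex.ofReal_zero, mul_zero,
    Complex.exp_zero, neg_div_neg_eq]

theorem fourier_dampedPow_one {μ : ℝ} (hμ : 0 < μ) (u : ℝ) :
    𝓕 (dampedPow μ 1) u = 1 / (μ + 2 * Real.pi * u * Complex.I) ^ 2 := by
  rw [fourier_dampedPow]
  simp only [pow_one]
  exact integral_mul_cexp_Ioi (re_add_mul_I_pos hμ u)

/-- The damping `e^{-μ(t - ∑ xᵢ)}` cancels the tilt and leaves `e^{-μt}`, while the one-sided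
support cuts out the truncated cube. Thus unweighted slack integrals become accessible to Fourier
inversion. -/
theorem cubeConvolution_dampedPow (n : ℕ) (μ : ℝ) (k : ℕ) (t : ℝ) :
    cubeConvolution n μ (dampedPow μ k) t =
      ↑(Real.exp (-μ * t) * ∫ x in truncatedCube n t, (t - ∑ i, x i) ^ k) := by
  rw [← integral_const_mul, ← integral_complex_ofReal, cubeConvolution, truncatedCube_eq,
    ← setIntegral_indicator (measurableSet_le (by fun_prop) measurable_const)]
  congr 1
  ext x
  by_cases hx : ∑ i, x i ≤ t
  · rw [Set.indicator_of_mem (by exact hx), dampedPow,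
      Set.indicator_of_mem (by simpa using hx), mul_left_comm, ← Complex.exp_add]
    push_cast
    rw [mul_comm]
    congr 2
    ring
  · rw [Set.indicator_of_notMem (by exact hx), dampedPow,
      Set.indicator_of_notMem (by simpa using hx), mul_zero]

end Shaping

/-! ### The centred characteristic function: domination and Gaussian limit -/

namespace Shaping
/-- The characteristic function of the centred truncated exponential law. -/
noncomputable def centredChar (α μ w : ℝ) : ℂ :=
  Complex.exp (α * w * Complex.I) * unitLaplace (μ + w * Complex.I) / expMass μ

/-- `μ²` times the variance of the truncated exponential law with mean `α`. -/
noncomputable def scaledVariance (α μ : ℝ) : ℝ := -μ + 2 * α * μ + μ ^ 2 * α * (1 - α)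

theorem add_mul_I_ne_zero {μ : ℝ} (hμ : 0 < μ) (w : ℝ) : (μ + w * Complex.I : ℂ) ≠ 0 := by
  intro h
  have := congrArg Complex.re h
  simp at this
  exact hμ.ne' this

theorem sq_mul_exp_neg_lt {μ : ℝ} (hμ : 0 < μ) :
    μ ^ 2 * Real.exp (-μ) < (1 - Real.exp (-μ)) ^ 2 := by
  have h := sq_mul_exp_lt hμ
  have hp := Real.exp_pos (-μ)
  have h1 : Real.exp μ * Real.exp (-μ) = 1 := by rw [← Real.exp_add]; simp
  have h2 := mul_lt_mul_of_pos_right h (mul_pos hp hp)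
  have h3 : μ ^ 2 * Real.exp μ * (Real.exp (-μ) * Real.exp (-μ)) = μ ^ 2 * Real.exp (-μ) := by
    linear_combination μ ^ 2 * Real.exp (-μ) * h1
  have h4 : (Real.exp μ - 1) ^ 2 * (Real.exp (-μ) * Real.exp (-μ)) = (1 - Real.exp (-μ)) ^ 2 := by
    linear_combination (Real.exp μ * Real.exp (-μ) + 1 - 2 * Real.exp (-μ)) * h1
  rwa [h3, h4] at h2

theorem scaledVariance_pos {α μ : ℝ} (h : IsDecayRate α μ) : 0 < scaledVariance α μ := by
  obtain ⟨hμ, rfl⟩ := h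
  have h1 := exp_sub_one_pos hμ
  have h2 : scaledVariance (1 / μ - 1 / (Real.exp μ - 1)) μ =
      ((Real.exp μ - 1) ^ 2 - μ ^ 2 * Real.exp μ) / (Real.exp μ - 1) ^ 2 := by
    unfold scaledVariance
    field_simp
    ring
  rw [h2]
  exact div_pos (sub_pos.2 (sq_mul_exp_lt hμ)) (by positivity)

theorem norm_centredChar_sq (α : ℝ) {μ : ℝ} (hμ : 0 < μ) (w : ℝ) : ‖centredChar α μ w‖ ^ 2 =
    ((1 - Real.exp (-μ)) ^ 2 + 2 * Real.exp (-μ) * (1 - Real.cos w)) / (μ ^ 2 + w ^ 2) *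
      (μ ^ 2 / (1 - Real.exp (-μ)) ^ 2) := by
  have hZ := expMass_pos hμ
  have h1 : ‖Complex.exp (α * w * Complex.I)‖ = 1 := by
    rw [← Complex.ofReal_mul]; exact Complex.norm_exp_ofReal_mul_I _
  have h2 : ‖(μ + w * Complex.I : ℂ)‖ ^ 2 = μ ^ 2 + w ^ 2 := by
    rw [← Complex.normSq_eq_norm_sq, Complex.normSq_add_mul_I]
  have h3 : ‖1 - Complex.exp (-(μ + w * Complex.I))‖ ^ 2 =
      (1 - Real.exp (-μ)) ^ 2 + 2 * Real.exp (-μ) * (1 - Real.cos w) := by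
    rw [← Complex.normSq_eq_norm_sq, Complex.normSq_apply]
    simp only [Complex.sub_re, Complex.sub_im, Complex.exp_re, Complex.exp_im, Complex.neg_re,
      Complex.neg_im, Complex.add_re, Complex.add_im, Complex.mul_re, Complex.mul_im,
      Complex.ofReal_re, Complex.ofReal_im, Complex.I_re, Complex.I_im, Complex.one_re,
      Complex.one_im, mul_zero, mul_one, sub_zero, add_zero, zero_add, Real.cos_neg,
      Real.sin_neg]
    linear_combination Real.exp (-μ) ^ 2 * Real.sin_sq_add_cos_sq w
  rw [centredChar, norm_div, norm_mul, h1, one_mul, unitLaplace, norm_div, div_pow, div_pow, h2, h3,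
    Complex.norm_real, Real.norm_of_nonneg hZ.le, expMass, div_pow, div_eq_mul_inv _ (_ / _), inv_div]

theorem exists_norm_centredChar_sq_le (α : ℝ) {μ : ℝ} (hμ : 0 < μ) :
    ∃ c : ℝ, 0 < c ∧ ∀ w, ‖centredChar α μ w‖ ^ 2 ≤ 1 / (1 + c * w ^ 2) := by
  have h := sq_mul_exp_neg_lt hμ
  have hq := Real.exp_pos (-μ)
  have hq1 : 0 < 1 - Real.exp (-μ) := sub_pos.2 (Real.exp_lt_one_iff.2 (by linarith))
  set q := Real.exp (-μ) with hqdef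
  -- After cross-multiplication, use `1 - cos w ≤ w²/2` in the term free of `c` and `1 - cos w ≤ 2`
  -- in the term with `c`. Since `(1 - q)² + 4q = (1 + q)²`, this `c` is what remains admissible.
  refine ⟨((1 - q) ^ 2 - μ ^ 2 * q) / (μ ^ 2 * (1 + q) ^ 2),
    div_pos (sub_pos.2 h) (by positivity), fun w => ?_⟩
  set c := ((1 - q) ^ 2 - μ ^ 2 * q) / (μ ^ 2 * (1 + q) ^ 2) with hc
  have hc0 : 0 < c := div_pos (sub_pos.2 h) (by positivity)
  have hcm : c * (μ ^ 2 * (1 + q) ^ 2) = (1 - q) ^ 2 - μ ^ 2 * q := by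
    rw [hc]; field_simp
  rw [norm_centredChar_sq α hμ, div_mul_div_comm, div_le_div_iff₀ (by positivity) (by positivity)]
  have h1 : 1 - Real.cos w ≤ w ^ 2 / 2 := by linarith [Real.one_sub_sq_div_two_le_cos (x := w)]
  have h2 : 1 - Real.cos w ≤ 2 := by linarith [Real.neg_one_le_cos w]
  have h3 : μ ^ 2 * q * (1 - Real.cos w) ≤ μ ^ 2 * q * (w ^ 2 / 2) := by gcongr
  have h4 : c * w ^ 2 * μ ^ 2 * q * (1 - Real.cos w) ≤ c * w ^ 2 * μ ^ 2 * q * 2 := by gcongr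
  have h5 : w ^ 2 * (c * (μ ^ 2 * (1 + q) ^ 2)) = w ^ 2 * ((1 - q) ^ 2 - μ ^ 2 * q) := by rw [hcm]
  rw [← hqdef]
  nlinarith [h3, h4, h5]

/-- A power of the centred characteristic function, on the scale of the central limit theorem, is
dominated by an integrable function. -/
theorem norm_centredChar_pow_le {α μ c : ℝ} (hc : 0 < c)
    (h : ∀ w, ‖centredChar α μ w‖ ^ 2 ≤ 1 / (1 + c * w ^ 2)) {n : ℕ} (hn : 2 ≤ n) (w : ℝ) :
    ‖centredChar α μ (w / √n) ^ n‖ ≤ (1 + c / 2 * w ^ 2)⁻¹ := by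
  have hn0 : (0 : ℝ) < n := by positivity
  have hn2 : (2 : ℝ) ≤ n := by exact_mod_cast hn
  have h1 := h (w / √n)
  rw [div_pow, Real.sq_sqrt hn0.le] at h1
  set y := ‖centredChar α μ (w / √n)‖
  have hy : 0 ≤ y := norm_nonneg _
  have hx : 0 ≤ c * (w ^ 2 / n) := by positivity
  rw [norm_pow]
  calc y ^ n = (y ^ 2) ^ ((n : ℝ) / 2) := by
        rw [← Real.rpow_natCast y 2, ← Real.rpow_mul hy, ← Real.rpow_natCast]
        congr 1; push_cast; ring
    _ ≤ (1 / (1 + c * (w ^ 2 / n))) ^ ((n : ℝ) / 2) := by gcongr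
    _ = ((1 + c * (w ^ 2 / n)) ^ ((n : ℝ) / 2))⁻¹ := by
        rw [one_div, Real.inv_rpow (by positivity)]
    _ ≤ _ := by
        gcongr
        -- Bernoulli's inequality with exponent `n / 2 ≥ 1`, whence the assumption `2 ≤ n`.
        have h2 := one_add_mul_self_le_rpow_one_add (s := c * (w ^ 2 / n)) (by linarith)
          (p := (n : ℝ) / 2) (by linarith)
        refine le_trans (le_of_eq ?_) h2
        field_simp

theorem norm_centredChar_le_one {α μ c : ℝ} (hc : 0 < c)
    (h : ∀ w, ‖centredChar α μ w‖ ^ 2 ≤ 1 / (1 + c * w ^ 2)) (w : ℝ) :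
    ‖centredChar α μ w‖ ≤ 1 := by
  have h1 : 1 / (1 + c * w ^ 2) ≤ 1 := by
    rw [div_le_one (by positivity)]
    nlinarith [mul_nonneg hc.le (sq_nonneg w)]
  have := (h w).trans h1
  nlinarith [norm_nonneg (centredChar α μ w)]

theorem integrable_inv_one_add_mul_sq {c : ℝ} (hc : 0 < c) :
    Integrable fun w : ℝ => (1 + c * w ^ 2)⁻¹ := by
  have h := integrable_inv_one_add_sq.comp_mul_left' (R := √c) (by positivity)
  simpa [mul_pow, Real.sq_sqrt hc.le] using h

/-- The remainder of the Taylor expansion of second order of the exponential. -/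
noncomputable def expRemainder (z : ℂ) : ℂ := Complex.exp z - 1 - z - z ^ 2 / 2

theorem tendsto_expRemainder_div (a : ℝ) :
    Tendsto (fun w : ℝ => expRemainder (w * a * Complex.I) / (w : ℂ) ^ 2) (nhds 0) (nhds 0) := by
  have hb : ∀ w : ℝ, ‖expRemainder (w * a * Complex.I) / (w : ℂ) ^ 2‖ ≤
      |w| * (|a| ^ 3 * Real.exp (|w| * |a|)) := by
    intro w
    rcases eq_or_ne w 0 with rfl | hw
    · simp
    have h := Complex.norm_exp_sub_sum_le_norm_mul_exp (w * a * Complex.I) 3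
    have h1 : Complex.exp (w * a * Complex.I) -
        ∑ m ∈ Finset.range 3, (w * a * Complex.I) ^ m / (m.factorial : ℂ) =
          expRemainder (w * a * Complex.I) := by
      simp [Finset.sum_range_succ, expRemainder]
      ring
    have h2 : ‖(w * a * Complex.I : ℂ)‖ = |w| * |a| := by simp
    rw [h1, h2] at h
    rw [norm_div, norm_pow, Complex.norm_real, Real.norm_eq_abs, div_le_iff₀ (by positivity)]
    refine h.trans (le_of_eq ?_)
    ring
  refine squeeze_zero_norm hb ?_
  have : Continuous fun w : ℝ => |w| * (|a| ^ 3 * Real.exp (|w| * |a|)) := by fun_prop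
  simpa using this.tendsto 0

/-- The second difference quotient at `0` of the centred characteristic function. -/
noncomputable def charQuotient (α μ w : ℝ) : ℂ :=
  (-scaledVariance α μ / (2 * μ) + μ * (1 + (1 / μ - α)) *
      (expRemainder (w * α * Complex.I) / (w : ℂ) ^ 2) -
    μ * (1 / μ - α) * (expRemainder (w * (α - 1 : ℝ) * Complex.I) / (w : ℂ) ^ 2)) /
      (μ + w * Complex.I)

theorem tendsto_charQuotient (α : ℝ) {μ : ℝ} (hμ : 0 < μ) :
    Tendsto (charQuotient α μ) (nhds 0) (nhds ((-scaledVariance α μ / (2 * μ ^ 2) : ℝ) : ℂ)) := by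
  have h1 : Tendsto (fun w : ℝ => (μ + w * Complex.I : ℂ)) (nhds 0) (nhds μ) := by
    have : Continuous fun w : ℝ => (μ + w * Complex.I : ℂ) := by fun_prop
    simpa using this.tendsto 0
  have hμ' : (μ : ℂ) ≠ 0 := by exact_mod_cast hμ.ne'
  have h := (((tendsto_const_nhds (x := (-scaledVariance α μ / (2 * μ) : ℂ))).add
    ((tendsto_expRemainder_div α).const_mul (μ * (1 + (1 / μ - α)) : ℂ))).sub
    ((tendsto_expRemainder_div (α - 1)).const_mul (μ * (1 / μ - α) : ℂ))).div h1 hμ'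
  have hlim : ((-scaledVariance α μ / (2 * μ ^ 2) : ℝ) : ℂ) =
      (-scaledVariance α μ / (2 * μ) + μ * (1 + (1 / μ - α)) * 0 - μ * (1 / μ - α) * 0) / μ := by
    push_cast
    field_simp
    ring
  rw [hlim]
  exact h

/-- With `b = 1/μ - α = 1/(e^μ - 1)`, the function is `μ((1 + b)e^{iwα} - b e^{iw(α-1)}) / (μ +
iw)`. In the numerator the terms of order at most one sum to `μ + iw` because `α + b = 1/μ`; the
quadratic term is `-D w² / (2μ)`. -/
theorem centredChar_eq {α μ : ℝ} (h : IsDecayRate α μ) (w : ℝ) :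
    centredChar α μ w = 1 + w ^ 2 * charQuotient α μ w := by
  have hμ := h.1
  have hμ' : (μ : ℂ) ≠ 0 := by exact_mod_cast hμ.ne'
  have hs := add_mul_I_ne_zero hμ w
  have hE := exp_sub_one_pos hμ
  have hb : 1 / μ - α = 1 / (Real.exp μ - 1) := by rw [h.2]; ring
  have hq1 : 0 < 1 - Real.exp (-μ) := sub_pos.2 (Real.exp_lt_one_iff.2 (by linarith))
  have hb1 : (1 / μ - α) * (1 - Real.exp (-μ)) = Real.exp (-μ) := by
    rw [hb, Real.exp_neg]; field_simp
  have hb1' : ((1 / μ - α) * (1 - Complex.exp (-μ)) : ℂ) = Complex.exp (-μ) := by exact_mod_cast hb1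
  have hq1' : (1 - Complex.exp (-μ) : ℂ) ≠ 0 := by exact_mod_cast hq1.ne'
  -- At `w = 0` the quotient is `0` by the convention for division by zero, and the remainder
  -- vanishes too.
  have hR : ∀ a : ℝ, (w : ℂ) ^ 2 * (expRemainder (w * a * Complex.I) / (w : ℂ) ^ 2) =
      expRemainder (w * a * Complex.I) := by
    intro a
    rcases eq_or_ne w 0 with rfl | hw
    · simp [expRemainder]
    · rw [mul_div_cancel₀]
      exact pow_ne_zero 2 (by exact_mod_cast hw)
  have h1 : Complex.exp (α * w * Complex.I) * (1 - Complex.exp (-(μ + w * Complex.I))) =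
      Complex.exp (w * α * Complex.I) -
        Complex.exp (-μ) * Complex.exp (w * (α - 1 : ℝ) * Complex.I) := by
    rw [mul_sub, mul_one, ← Complex.exp_add, ← Complex.exp_add]
    congr 2
    · ring
    · push_cast; ring
  have hL : centredChar α μ w = μ * ((1 + (1 / μ - α)) * Complex.exp (w * α * Complex.I) -
      (1 / μ - α) * Complex.exp (w * (α - 1 : ℝ) * Complex.I)) / (μ + w * Complex.I) := by
    rw [centredChar, unitLaplace, expMass, ← mul_div_assoc, h1]
    push_cast
    have h2 : (1 + (1 / μ - α) : ℂ) = 1 / (1 - Complex.exp (-μ)) := by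
      rw [eq_div_iff hq1']; linear_combination hb1'
    have h3 : (1 / μ - α : ℂ) = Complex.exp (-μ) / (1 - Complex.exp (-μ)) := by
      rw [eq_div_iff hq1']; exact hb1'
    rw [h2, h3]
    field_simp
  have hQ : (w : ℂ) ^ 2 * charQuotient α μ w = (-scaledVariance α μ / (2 * μ) * w ^ 2 +
      μ * (1 + (1 / μ - α)) * expRemainder (w * α * Complex.I) -
        μ * (1 / μ - α) * expRemainder (w * (α - 1 : ℝ) * Complex.I)) / (μ + w * Complex.I) := by
    rw [charQuotient, ← mul_div_assoc]
    congr 1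
    linear_combination (μ * (1 + (1 / μ - α)) : ℂ) * hR α - (μ * (1 / μ - α) : ℂ) * hR (α - 1)
  rw [hL, hQ, eq_comm, eq_div_iff hs, add_mul, div_mul_cancel₀ _ hs]
  simp only [expRemainder, scaledVariance]
  push_cast
  field_simp
  ring_nf
  simp only [Complex.I_sq]
  ring

/-- The central limit theorem in the form `(1 + zₙ)^n → e^z` when `n zₙ → z`, with `zₙ` the
quadratic correction at `w / √n`. -/
theorem tendsto_centredChar_pow {α μ : ℝ} (h : IsDecayRate α μ) (w : ℝ) :
    Tendsto (fun n : ℕ => centredChar α μ (w / √n) ^ n) atTop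
      (nhds (Complex.exp ((-(scaledVariance α μ / (2 * μ ^ 2)) * w ^ 2 : ℝ)))) := by
  simp_rw [centredChar_eq h]
  apply Complex.tendsto_one_add_pow_exp_of_tendsto
  have h1 : Tendsto (fun n : ℕ => w / √n) atTop (nhds 0) :=
    (Real.tendsto_sqrt_atTop.comp tendsto_natCast_atTop_atTop).const_div_atTop w
  have h2 := ((tendsto_charQuotient α h.1).comp h1).const_mul ((w : ℂ) ^ 2)
  have h3 : ((-(scaledVariance α μ / (2 * μ ^ 2)) * w ^ 2 : ℝ) : ℂ) =
      (w : ℂ) ^ 2 * ((-scaledVariance α μ / (2 * μ ^ 2) : ℝ) : ℂ) := by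
    push_cast; ring
  rw [h3]
  refine h2.congr' ?_
  filter_upwards [eventually_gt_atTop 0] with n hn
  have hn0 : (0 : ℝ) < n := by exact_mod_cast hn
  have h4 : (n : ℂ) * ((w / √n : ℝ) : ℂ) ^ 2 = w ^ 2 := by
    have : (n : ℝ) * (w / √n) ^ 2 = w ^ 2 := by
      rw [div_pow, Real.sq_sqrt hn0.le]; field_simp
    exact_mod_cast this
  rw [← mul_assoc, h4]
  rfl

end Shaping

/-! ### The local limit theorem, the optimal level and the volume -/

namespace Shaping

/-- The integral of the `k`-th power of the slack `t - ∑ xᵢ` over the truncated cube. -/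
noncomputable def slackMoment (n k : ℕ) (t : ℝ) : ℝ :=
  ∫ x in truncatedCube n t, (t - ∑ i, x i) ^ k

theorem slackMoment_zero (n : ℕ) (t : ℝ) :
    slackMoment n 0 t = volume.real (truncatedCube n t) := by
  simp [slackMoment]

theorem slackMoment_one (n : ℕ) (t : ℝ) :
    slackMoment n 1 t = t * volume.real (truncatedCube n t) - sumMoment n t := by
  simp only [slackMoment, pow_one]
  exact integral_sub_sum_of_subset_cube (truncatedCube_subset n t) t

theorem continuous_slackMoment {n : ℕ} (hn : 1 ≤ n) {k : ℕ} (hk : k ≤ 1) :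
    Continuous (slackMoment n k) := by
  interval_cases k
  · exact (continuous_volume_truncatedCube n hn).congr fun t => (slackMoment_zero n t).symm
  · exact ((continuous_id.mul (continuous_volume_truncatedCube n hn)).sub
      (continuous_sumMoment n hn)).congr fun t => (slackMoment_one n t).symm

theorem fourier_dampedPow_eq {μ : ℝ} (hμ : 0 < μ) {k : ℕ} (hk : k ≤ 1) (u : ℝ) :
    𝓕 (dampedPow μ k) u = 1 / (μ + 2 * Real.pi * u * Complex.I) ^ (k + 1) := by
  interval_cases k
  · rw [fourier_dampedPow_zero hμ, pow_one]
  · exact fourier_dampedPow_one hμ u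

theorem norm_one_div_pow_le {μ : ℝ} (hμ : 0 < μ) (k : ℕ) (u : ℝ) :
    ‖(1 / (μ + 2 * Real.pi * u * Complex.I) ^ (k + 1) : ℂ)‖ ≤ 1 / μ ^ (k + 1) := by
  rw [norm_div, norm_one, norm_pow]
  gcongr
  have h := Complex.abs_re_le_norm (μ + 2 * Real.pi * u * Complex.I)
  simpa [abs_of_pos hμ] using h

theorem measurable_centredChar (α μ : ℝ) : Measurable (centredChar α μ) := by
  unfold centredChar unitLaplace
  fun_prop

theorem unitLaplace_eq (α : ℝ) {μ : ℝ} (hμ : 0 < μ) (u : ℝ) :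
    unitLaplace (μ + 2 * Real.pi * u * Complex.I) =
      expMass μ * (centredChar α μ (2 * Real.pi * u) *
        Complex.exp (-(α * (2 * Real.pi * u) * Complex.I))) := by
  have hZ : (expMass μ : ℂ) ≠ 0 := by exact_mod_cast (expMass_pos hμ).ne'
  have h : Complex.exp (α * (2 * Real.pi * u) * Complex.I) *
      Complex.exp (-(α * (2 * Real.pi * u) * Complex.I)) = 1 := by
    rw [← Complex.exp_add, add_neg_cancel, Complex.exp_zero]
  rw [centredChar]
  push_cast
  rw [div_mul_eq_mul_div, mul_div_cancel₀ _ hZ]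
  linear_combination (-unitLaplace (μ + 2 * Real.pi * u * Complex.I)) * h

/-- The first factor is merely bounded; integrability comes from two powers of the characteristic
function, hence `2 ≤ n`. -/
theorem integrable_pow_mul_centredChar_pow (α : ℝ) {μ : ℝ} (hμ : 0 < μ) (k : ℕ) {n : ℕ}
    (hn : 2 ≤ n) : Integrable fun u : ℝ =>
      (1 / (μ + 2 * Real.pi * u * Complex.I) ^ (k + 1) : ℂ) *
        centredChar α μ (2 * Real.pi * u) ^ n := by
  obtain ⟨c, hc, hb⟩ := exists_norm_centredChar_sq_le α hμ
  have hd := integrable_inv_one_add_mul_sq (c := c * (2 * Real.pi) ^ 2) (by positivity)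
  have hm := measurable_centredChar α μ
  refine (hd.const_mul (1 / μ ^ (k + 1))).mono' (Measurable.aestronglyMeasurable (by fun_prop)) ?_
  refine Eventually.of_forall fun u => ?_
  rw [norm_mul, norm_pow]
  refine mul_le_mul (norm_one_div_pow_le hμ k u) ?_ (by positivity) (by positivity)
  calc ‖centredChar α μ (2 * Real.pi * u)‖ ^ n ≤ ‖centredChar α μ (2 * Real.pi * u)‖ ^ 2 :=
        pow_le_pow_of_le_one (norm_nonneg _) (norm_centredChar_le_one hc hb _) hn
    _ ≤ _ := hb _
    _ = _ := by rw [one_div, mul_pow _ u, mul_assoc]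

/-- The slack moments as Fourier integrals on the scale of the central limit theorem. -/
theorem slackMoment_eq_integral (α : ℝ) {μ : ℝ} (hμ : 0 < μ) {k : ℕ} (hk : k ≤ 1) {n : ℕ}
    (hn : 2 ≤ n) (c : ℝ) :
    ((√n * (expMass μ ^ n)⁻¹ *
      (Real.exp (-μ * (n * α + c)) * slackMoment n k (n * α + c)) : ℝ) : ℂ) =
      ∫ v : ℝ, Complex.exp (↑(2 * Real.pi * (v / √n) * c) * Complex.I) *
        ((1 / (μ + 2 * Real.pi * (v / √n : ℝ) * Complex.I) ^ (k + 1) : ℂ) *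
          centredChar α μ (2 * Real.pi * (v / √n)) ^ n) := by
  have hn0 : (0 : ℝ) < n := by positivity
  have hZ : (expMass μ : ℂ) ≠ 0 := by exact_mod_cast (expMass_pos hμ).ne'
  -- Centring produces the phase `e^{-2πiunα}`, which inversion at `nα + c` cancels up to the phase
  -- of `c`.
  have hF : (fun u : ℝ => 𝓕 (dampedPow μ k) u *
      unitLaplace (μ + 2 * Real.pi * u * Complex.I) ^ n) = fun u : ℝ =>
        Complex.exp (↑(-(2 * Real.pi * u * (n * α))) * Complex.I) *
        ((expMass μ : ℂ) ^ n * ((1 / (μ + 2 * Real.pi * u * Complex.I) ^ (k + 1) : ℂ) *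
          centredChar α μ (2 * Real.pi * u) ^ n)) := by
    ext u
    rw [fourier_dampedPow_eq hμ hk, unitLaplace_eq α hμ, mul_pow, mul_pow, ← Complex.exp_nat_mul]
    have : (n * -(α * (2 * Real.pi * u) * Complex.I) : ℂ) =
        ↑(-(2 * Real.pi * u * (n * α))) * Complex.I := by push_cast; ring
    rw [this]
    ring
  have hi : Integrable fun u : ℝ => 𝓕 (dampedPow μ k) u *
      unitLaplace (μ + 2 * Real.pi * u * Complex.I) ^ n := by
    rw [hF]
    refine Integrable.bdd_mul (c := 1)
      ((integrable_pow_mul_centredChar_pow α hμ k hn).const_mul _) ?_ ?_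
    · exact Continuous.aestronglyMeasurable (by fun_prop)
    · exact Eventually.of_forall fun p => (Complex.norm_exp_ofReal_mul_I _).le
  have hcc : Continuous (cubeConvolution n μ (dampedPow μ k)) := by
    have h1 : cubeConvolution n μ (dampedPow μ k) =
        fun t => ((Real.exp (-μ * t) * slackMoment n k t : ℝ) : ℂ) :=
      funext (cubeConvolution_dampedPow n μ k)
    have h2 := continuous_slackMoment (show 1 ≤ n by omega) hk
    rw [h1]
    fun_prop
  have h := cubeConvolution_eq_integral n hμ (measurable_dampedPow μ k) (integrable_dampedPow hμ k)
    hcc hi (n * α + c)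
  have hint : ∀ u : ℝ, Complex.exp (↑(2 * Real.pi * u * (n * α + c)) * Complex.I) *
      (𝓕 (dampedPow μ k) u * unitLaplace (μ + 2 * Real.pi * u * Complex.I) ^ n) =
      (expMass μ : ℂ) ^ n * (Complex.exp (↑(2 * Real.pi * u * c) * Complex.I) *
        ((1 / (μ + 2 * Real.pi * u * Complex.I) ^ (k + 1) : ℂ) *
          centredChar α μ (2 * Real.pi * u) ^ n)) := by
    intro u
    rw [congrFun hF u, ← mul_assoc, ← Complex.exp_add]
    have : (↑(2 * Real.pi * u * (n * α + c)) * Complex.I +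
        ↑(-(2 * Real.pi * u * (n * α))) * Complex.I : ℂ) =
          ↑(2 * Real.pi * u * c) * Complex.I := by push_cast; ring
    rw [this]
    ring
  simp_rw [hint] at h
  rw [integral_const_mul, cubeConvolution_dampedPow] at h
  -- The substitution `u = v / √n` produces the factor `√n`.
  have hsub := Measure.integral_comp_div (fun u : ℝ =>
    Complex.exp (↑(2 * Real.pi * u * c) * Complex.I) *
        ((1 / (μ + 2 * Real.pi * u * Complex.I) ^ (k + 1) : ℂ) *
          centredChar α μ (2 * Real.pi * u) ^ n)) √n
  rw [hsub, abs_of_nonneg (Real.sqrt_nonneg _), Complex.real_smul, Complex.ofReal_mul, slackMoment, h,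
    Complex.ofReal_mul, Complex.ofReal_inv, Complex.ofReal_pow, mul_assoc,
    inv_mul_cancel_left₀ (pow_ne_zero n hZ)]

/-- **Local limit theorem** for the slack moments at a level `nα + o(√n)`. -/
theorem tendsto_slackMoment {α μ : ℝ} (h : IsDecayRate α μ) {k : ℕ} (hk : k ≤ 1) {c : ℕ → ℝ}
    (hc : Tendsto (fun n : ℕ => c n / √n) atTop (nhds 0)) :
    Tendsto (fun n : ℕ => √n * (expMass μ ^ n)⁻¹ *
      (Real.exp (-μ * (n * α + c n)) * slackMoment n k (n * α + c n))) atTop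
      (nhds (1 / (μ ^ k * √(2 * Real.pi * scaledVariance α μ)))) := by
  have hμ := h.1
  have hμ' : (μ : ℂ) ≠ 0 := by exact_mod_cast hμ.ne'
  have hD := scaledVariance_pos h
  obtain ⟨C, hC, hb⟩ := exists_norm_centredChar_sq_le α hμ
  have hm := measurable_centredChar α μ
  -- The Gaussian integral is `μ / √(2πD)`; the frozen factor `1/μ^(k+1)` multiplies it.
  have hlim : (∫ v : ℝ, (1 * ((1 / (μ + 2 * Real.pi * (0 : ℝ) * Complex.I) ^ (k + 1) : ℂ) *
      Complex.exp ((-(scaledVariance α μ / (2 * μ ^ 2)) * (2 * Real.pi * v) ^ 2 : ℝ))))) =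
        ((1 / (μ ^ k * √(2 * Real.pi * scaledVariance α μ)) : ℝ) : ℂ) := by
    have h1 : ∀ v : ℝ, -(scaledVariance α μ / (2 * μ ^ 2)) * (2 * Real.pi * v) ^ 2 =
        -(2 * Real.pi ^ 2 * scaledVariance α μ / μ ^ 2) * v ^ 2 := by
      intro v
      field_simp
    simp_rw [h1, ← Complex.ofReal_exp]
    rw [integral_const_mul, integral_const_mul, integral_complex_ofReal, integral_gaussian]
    have h2 : Real.pi / (2 * Real.pi ^ 2 * scaledVariance α μ / μ ^ 2) =
        μ ^ 2 / (2 * Real.pi * scaledVariance α μ) := by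
      field_simp
    rw [h2, Real.sqrt_div (by positivity), Real.sqrt_sq hμ.le]
    push_cast
    have h3 : ((√(2 * Real.pi * scaledVariance α μ) : ℝ) : ℂ) ≠ 0 := by
      exact_mod_cast (Real.sqrt_pos.2 (by positivity)).ne'
    field_simp
    ring
  have key : Tendsto (fun n : ℕ => ∫ v : ℝ,
      Complex.exp (↑(2 * Real.pi * (v / √n) * c n) * Complex.I) *
        ((1 / (μ + 2 * Real.pi * (v / √n : ℝ) * Complex.I) ^ (k + 1) : ℂ) *
          centredChar α μ (2 * Real.pi * (v / √n)) ^ n)) atTop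
      (nhds (∫ v : ℝ, (1 * ((1 / (μ + 2 * Real.pi * (0 : ℝ) * Complex.I) ^ (k + 1) : ℂ) *
        Complex.exp ((-(scaledVariance α μ / (2 * μ ^ 2)) * (2 * Real.pi * v) ^ 2 : ℝ)))))) := by
    refine tendsto_integral_filter_of_dominated_convergence
      (fun v => 1 / μ ^ (k + 1) * (1 + C / 2 * (2 * Real.pi) ^ 2 * v ^ 2)⁻¹) ?_ ?_ ?_ ?_
    · exact Eventually.of_forall fun n => Measurable.aestronglyMeasurable (by fun_prop)
    · filter_upwards [eventually_ge_atTop 2] with n hn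
      refine Eventually.of_forall fun v => ?_
      rw [norm_mul, Complex.norm_exp_ofReal_mul_I, one_mul, norm_mul]
      refine mul_le_mul (norm_one_div_pow_le hμ k _) ?_ (norm_nonneg _) (by positivity)
      rw [← mul_div_assoc, mul_assoc (C / 2), ← mul_pow]
      exact norm_centredChar_pow_le hC hb hn _
    · exact (integrable_inv_one_add_mul_sq (by positivity)).const_mul _
    · refine Eventually.of_forall fun v => ?_
      have hv : Tendsto (fun n : ℕ => v / √n) atTop (nhds 0) :=
        (Real.tendsto_sqrt_atTop.comp tendsto_natCast_atTop_atTop).const_div_atTop v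
      refine Tendsto.mul ?_ (Tendsto.mul ?_ ?_)
      · have h1 : Tendsto (fun n : ℕ => 2 * Real.pi * (v / √n) * c n) atTop (nhds 0) := by
          have := hc.const_mul (2 * Real.pi * v)
          rw [mul_zero] at this
          refine this.congr fun n => ?_
          ring
        have h2 : Continuous fun x : ℝ => Complex.exp (x * Complex.I) := by fun_prop
        have h3 := (h2.tendsto 0).comp h1
        rwa [Complex.ofReal_zero, zero_mul, Complex.exp_zero] at h3
      · have h2 : Continuous fun x : ℝ =>
            (1 / (μ + 2 * Real.pi * x * Complex.I) ^ (k + 1) : ℂ) := by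
          refine continuous_const.div (by fun_prop) fun x => pow_ne_zero _ fun h0 => ?_
          have := re_add_mul_I_pos hμ x
          rw [h0] at this
          exact lt_irrefl _ this
        exact (h2.tendsto 0).comp hv
      · simp_rw [← mul_div_assoc]
        exact tendsto_centredChar_pow h _
  rw [hlim] at key
  have key2 : Tendsto (fun n : ℕ => ((√n * (expMass μ ^ n)⁻¹ *
      (Real.exp (-μ * (n * α + c n)) * slackMoment n k (n * α + c n)) : ℝ) : ℂ)) atTop
      (nhds ((1 / (μ ^ k * √(2 * Real.pi * scaledVariance α μ)) : ℝ) : ℂ)) := by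
    refine key.congr' ?_
    filter_upwards [eventually_ge_atTop 2] with n hn
    exact (slackMoment_eq_integral α hμ hk hn (c n)).symm
  simpa only [Function.comp_def, Complex.ofReal_re] using
    (Complex.continuous_re.tendsto _).comp key2

theorem tendsto_const_div_sqrt {c : ℕ → ℝ} {a : ℝ} (hc : Tendsto c atTop (nhds a)) :
    Tendsto (fun n : ℕ => c n / √n) atTop (nhds 0) :=
  hc.div_atTop (Real.tendsto_sqrt_atTop.comp tendsto_natCast_atTop_atTop)

/-- The mean coordinate sum of the cube truncated at `nα + c` is `nα + c - 1/μ + o(1)`. -/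
theorem tendsto_mean_sub {α μ : ℝ} (h : IsDecayRate α μ) (hα₀ : 0 < α) (hα₁ : α < 1) (c : ℝ) :
    Tendsto (fun n : ℕ => sumMoment n (n * α + c) / volume.real (truncatedCube n (n * α + c)) -
      n * α) atTop (nhds (c - 1 / μ)) := by
  have hμ := h.1
  have hD := scaledVariance_pos h
  have hs : 0 < √(2 * Real.pi * scaledVariance α μ) := Real.sqrt_pos.2 (by positivity)
  have hc := tendsto_const_div_sqrt (tendsto_const_nhds (x := c))
  have h0 := tendsto_slackMoment h zero_le_one hc
  have h1 := tendsto_slackMoment h le_rfl hc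
  -- All normalisations cancel in the ratio, which is the mean slack.
  have h2 := h1.div h0 (by positivity)
  have h3 : 1 / (μ ^ 1 * √(2 * Real.pi * scaledVariance α μ)) /
      (1 / (μ ^ 0 * √(2 * Real.pi * scaledVariance α μ))) = 1 / μ := by field_simp
  rw [h3] at h2
  refine (h2.const_sub c).congr' ?_
  have e0 : ∀ᶠ n : ℕ in atTop, 0 < n * α + c :=
    (((tendsto_natCast_atTop_atTop (R := ℝ)).atTop_mul_const hα₀).atTop_add
      tendsto_const_nhds).eventually_gt_atTop 0
  have e1 : ∀ᶠ n : ℕ in atTop, c ≤ n * (1 - α) :=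
    ((tendsto_natCast_atTop_atTop (R := ℝ)).atTop_mul_const (sub_pos.2 hα₁)).eventually_ge_atTop c
  filter_upwards [e0, e1, eventually_ge_atTop 1] with n h4 h5 hn
  have hV := volume_truncatedCube_pos n hn h4 (by linarith)
  have hn0 : (0 : ℝ) < n := by positivity
  have hsq := Real.sqrt_pos.2 hn0
  have hZ := expMass_pos hμ
  have hE := Real.exp_pos (-μ * (n * α + c))
  simp only [Pi.div_apply, slackMoment_zero, slackMoment_one]
  rw [mul_div_mul_left _ _ (by positivity), mul_div_mul_left _ _ hE.ne', sub_div,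
    mul_div_cancel_right₀ _ hV.ne']
  ring

theorem le_of_mean_le {n : ℕ} (hn : 1 ≤ n) {s t : ℝ} (hs : s ≤ n) (ht : 0 < t)
    (h : sumMoment n s / volume.real (truncatedCube n s) ≤
      sumMoment n t / volume.real (truncatedCube n t)) : s ≤ t := by
  by_contra! hlt
  exact absurd (sumMoment_div_strictMono n hn ht hlt hs) (not_lt.2 h)

/-- Levels `nα + 1/μ ± ε/2` have mean `nα ± ε/2 + o(1)`, so monotonicity of the mean traps the
optimal level between them. -/
theorem tendsto_truncation_level {α μ : ℝ} (h : IsDecayRate α μ) (hα₀ : 0 < α) (hα₁ : α < 1)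
    {t : ℕ → ℝ} (ht : ∀ n : ℕ, 1 ≤ n → t n ∈ Set.Ioc (0 : ℝ) n ∧
      averageFirstMoment (truncatedCube n (t n)) = α) :
    Tendsto (fun n : ℕ => t n - n * α) atTop (nhds (1 / μ)) := by
  rw [Metric.tendsto_nhds]
  intro ε hε
  have hu := tendsto_mean_sub h hα₀ hα₁ (1 / μ + ε / 2)
  have hl := tendsto_mean_sub h hα₀ hα₁ (1 / μ - ε / 2)
  have e0 : ∀ᶠ n : ℕ in atTop, -(1 / μ - ε / 2) < n * α :=
    ((tendsto_natCast_atTop_atTop (R := ℝ)).atTop_mul_const hα₀).eventually_gt_atTop _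
  have e1 : ∀ᶠ n : ℕ in atTop, 1 / μ + ε / 2 ≤ n * (1 - α) :=
    ((tendsto_natCast_atTop_atTop (R := ℝ)).atTop_mul_const (sub_pos.2 hα₁)).eventually_ge_atTop _
  filter_upwards [hu.eventually_const_lt (show (0 : ℝ) < _ by linarith),
    hl.eventually_lt_const (show _ < (0 : ℝ) by linarith), e0, e1, eventually_ge_atTop 1]
    with n hun hln h0 h1 hn
  obtain ⟨hmem, hav⟩ := ht n hn
  rw [averageFirstMoment_truncatedCube_eq_iff n hn] at hav
  have hup : t n ≤ n * α + (1 / μ + ε / 2) :=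
    le_of_mean_le hn hmem.2 (by linarith) (by rw [hav]; linarith)
  have hlo : n * α + (1 / μ - ε / 2) ≤ t n :=
    le_of_mean_le hn (by linarith) hmem.1 (by rw [hav]; linarith)
  rw [Real.dist_eq, abs_lt]
  constructor <;> linarith

/-- The volume of the optimal truncated cube, up to a factor `1 + o(1)`. -/
theorem tendsto_log_volume {α μ : ℝ} (h : IsDecayRate α μ) (hα₀ : 0 < α) (hα₁ : α < 1)
    {t : ℕ → ℝ} (ht : ∀ n : ℕ, 1 ≤ n → t n ∈ Set.Ioc (0 : ℝ) n ∧
      averageFirstMoment (truncatedCube n (t n)) = α) :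
    Tendsto (fun n : ℕ => Real.log (volume.real (truncatedCube n (t n))) -
      (n * (Real.log (expMass μ) + μ * α) - Real.log n / 2 + omegaConst α μ)) atTop (nhds 0) := by
  have hμ := h.1
  have hD := scaledVariance_pos h
  have hZ := expMass_pos hμ
  have hs : 0 < √(2 * Real.pi * scaledVariance α μ) := Real.sqrt_pos.2 (by positivity)
  have hc := tendsto_truncation_level h hα₀ hα₁ ht
  have h0 := (tendsto_slackMoment h zero_le_one (tendsto_const_div_sqrt hc)).log (by positivity)
  have h1 := (h0.add (hc.const_mul μ)).sub_const (omegaConst α μ)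
  -- The summand `μ * (1 / μ)`, from the limiting offset of the level, is the `1` in `omegaConst`.
  have h2 : Real.log (1 / (μ ^ 0 * √(2 * Real.pi * scaledVariance α μ))) + μ * (1 / μ) -
      omegaConst α μ = 0 := by
    rw [pow_zero, one_mul, one_div, Real.log_inv, Real.log_sqrt (by positivity), omegaConst,
      ← scaledVariance, mul_one_div_cancel hμ.ne']
    ring
  rw [h2] at h1
  refine h1.congr' ?_
  filter_upwards [eventually_ge_atTop 1] with n hn
  have hn0 : (0 : ℝ) < n := by positivity
  have hV := volume_truncatedCube_pos n hn (ht n hn).1.1 (ht n hn).1.2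
  rw [add_sub_cancel, slackMoment_zero, Real.log_mul (by positivity) (by positivity),
    Real.log_mul (by positivity) (by positivity), Real.log_mul (by positivity) hV.ne',
    Real.log_exp, Real.log_inv, Real.log_pow, Real.log_sqrt hn0.le]
  ring

end Shaping

/-! ### Assembly of the theorem -/

theorem theorem3 (α : ℝ) (hα₀ : 0 < α) (hα₁ : α < 1 / 2) :
    -- the maximum shaping gain is attained by the optimal truncated cube
    (∀ n : ℕ, 1 ≤ n →
      IsGreatest (Shaping.admissibleGains n α) (Shaping.maxShapingGain n α) ∧
      (∃! t : ℝ, t ∈ Set.Ioc (0 : ℝ) n ∧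
        Shaping.averageFirstMoment (Shaping.truncatedCube n t) = α) ∧
      ∀ t : ℝ, t ∈ Set.Ioc (0 : ℝ) n →
        Shaping.averageFirstMoment (Shaping.truncatedCube n t) = α →
        Shaping.IsAdmissible α (Shaping.truncatedCube n t) ∧
        Shaping.maxShapingGain n α = Shaping.shapingGain α (Shaping.truncatedCube n t)) ∧
    -- the decay rate exists and is unique
    (∃! μ : ℝ, Shaping.IsDecayRate α μ) ∧
    -- the second-order expansion
    ∀ μ : ℝ, Shaping.IsDecayRate α μ →
      (fun n : ℕ => Real.log (Shaping.maxShapingGain n α) -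
          (Shaping.differentialEntropy (Shaping.truncatedExpDensity μ) - Real.log (2 * α)
            - Real.log n / (2 * n) + Shaping.omegaConst α μ / n))
        =o[atTop] fun n : ℕ => 1 / (n : ℝ) := by
  refine ⟨fun n hn => ?_, Shaping.existsUnique_isDecayRate hα₀ hα₁, fun μ h => ?_⟩
  · have hex := Shaping.existsUnique_truncation_level hα₀ hα₁ n hn
    obtain ⟨t, ⟨ht, hav⟩, -⟩ := id hex
    refine ⟨?_, hex, fun s hs hs' => ⟨Shaping.isAdmissible_truncatedCube hn hs hs',
      Shaping.maxShapingGain_eq hα₀ hn hs hs'⟩⟩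
    rw [Shaping.maxShapingGain_eq hα₀ hn ht hav]
    exact Shaping.isGreatest_shapingGain_truncatedCube hα₀ hn ht hav
  · have hex : ∀ n : ℕ, ∃ t : ℝ, 1 ≤ n → t ∈ Set.Ioc (0 : ℝ) n ∧
        Shaping.averageFirstMoment (Shaping.truncatedCube n t) = α := by
      intro n
      by_cases hn : 1 ≤ n
      · obtain ⟨t, ht, -⟩ := Shaping.existsUnique_truncation_level hα₀ hα₁ n hn
        exact ⟨t, fun _ => ht⟩
      · exact ⟨0, fun hn' => absurd hn' hn⟩
    choose t ht using hex
    have hlim := Shaping.tendsto_log_volume h hα₀ (by linarith) ht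
    -- The logarithm of the gain is `log vol / n - log (2α)`, so an `o(1)` error in `log vol`
    -- becomes `o(1/n)`.
    have ho := ((isLittleO_one_iff ℝ).2 hlim).mul_isBigO
      (isBigO_refl (fun n : ℕ => 1 / (n : ℝ)) atTop)
    simp only [one_mul] at ho
    refine ho.congr' ?_ EventuallyEq.rfl
    filter_upwards [eventually_ge_atTop 1] with n hn
    have hn0 : (0 : ℝ) < n := by positivity
    have hV := Shaping.volume_truncatedCube_pos n hn (ht n hn).1.1 (ht n hn).1.2
    rw [Shaping.maxShapingGain_eq hα₀ hn (ht n hn).1 (ht n hn).2, Shaping.shapingGain,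
      Real.log_div (Real.rpow_pos_of_pos hV _).ne' (by positivity), Real.log_rpow hV,
      Shaping.differentialEntropy_truncatedExpDensity h]
    field_simp
    ring
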